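/- Let $\mathcal X$ be a measurable space and $\mathcal Y=\{\pm1\}$. For a class $\mathcal H\subseteq\mathcal Y^{\mathcal X}$, a collection $\mathcal T$ of maps $T:\mathcal X\to\mathcal X$ and a probability distribution $\mathcal D$ on $\mathcal X\times\mathcal Y$, put \[ \mathrm{err}(h,T(\mathcal D))=\Pr_{(x,y)\sim\mathcal D}[h(T(x))\ne y],\qquad \mathsf{OPT}_\infty=\inf_{h\in\mathcal H}\sup_{T\in\mathcal T}\mathrm{err}(h,T(\mathcal D)), \] and, for a sample $S=((x_1,y_1),\dots,(x_m,y_m))$, put $\mathrm{err}(h,T(S))=\frac1m\sum_{i=1}^m\mathbb 1[h(T(x_i))\ne y_i]$. Let $\mathrm{vc}(\mathcal H\circ\mathcal T)$ be the VC dimension of $\mathcal H\circ\mathcal T=\{h\circ T:h\in\mathcal H,\,T\in\mathcal T\}$. Assume the usual measurability conventions: every $h\circ T$ is measurable, and for every $n$ the quantity $\sup_{h\in\mathcal H,\,T\in\mathcal T}|\mathrm{err}(h,T(S))-\mathrm{err}(h,T(S'))|$ is measurable (with respect to the completed product measure) as a function of two independent samples $S,S'\sim\mathcal D^n$. There is a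 universal constant $C>0$ such that, for all such $\mathcal X,\mathcal H,\mathcal T,\mathcal D$ with $\mathrm{vc}(\mathcal H\circ\mathcal T)<\infty$, all $\varepsilon,\delta\in(0,\frac12)$ and all \[ m\ \ge\ C\,\frac{\mathrm{vc}(\mathcal H\circ\mathcal T)+\log(1/\delta)}{\varepsilon^2}, \] with probability at least $1-\delta$ over $S\sim\mathcal D^m$, every empirical min-max predictor $\hat h\in\operatorname{argmin}_{h\in\mathcal H}\max_{T\in\mathcal T}\mathrm{err}(h,T(S))$ satisfies \[ \sup_{T\in\mathcal T}\mathrm{err}(\hat h,T(\mathcal D))\le\mathsf{OPT}_\infty+\varepsilon . \] -/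

import Mathlib

open MeasureTheory

noncomputable section

/-- The label space `{+1, -1}`, with its discrete σ-algebra. -/
abbrev Label : Type := ℤˣ

instance : MeasurableSingletonClass Label :=
  ⟨fun y => ⟨{(y : ℤ)}, measurableSet_singleton _, by ext z; simp [Units.ext_iff]⟩⟩

/-- The composition `H ∘ 𝒯 = {h ∘ T : h ∈ H, T ∈ 𝒯}`. -/
def compClass {X : Type*} (H : Set (X → Label)) (𝒯 : Set (X → X)) : Set (X → Label) :=
  {g | ∃ h ∈ H, ∃ T ∈ 𝒯, g = h ∘ T}

/-- The class `F` shatters the finite set `s`: every labelling of `s` is realised on `s` by some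
member of `F`. -/
def Shatters {X : Type*} (F : Set (X → Label)) (s : Finset X) : Prop :=
  ∀ y : X → Label, ∃ f ∈ F, ∀ x ∈ s, f x = y x

/-- The VC dimension of `F`: the supremum, possibly `⊤`, of the sizes of the finite sets that `F`
shatters. -/
def vc {X : Type*} (F : Set (X → Label)) : ℕ∞ :=
  ⨆ (s : Finset X) (_ : Shatters F s), (s.card : ℕ∞)

/-- The error `err(h, T(D)) = P_{(x,y) ∼ D} [h (T x) ≠ y]`. -/
def err {X : Type*} [MeasurableSpace X] (D : Measure (X × Label)) (h : X → Label) (T : X → X) :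
    ℝ :=
  D.real {z | h (T z.1) ≠ z.2}

/-- The worst-case error `sup_{T ∈ 𝒯} err(h, T(D))`
(a supremum of numbers in `[0, 1]`; it is `0` if `𝒯` is empty). -/
def worstErr {X : Type*} [MeasurableSpace X] (D : Measure (X × Label)) (𝒯 : Set (X → X))
    (h : X → Label) : ℝ :=
  ⨆ T : 𝒯, err D h T

/-- `OPT_∞ = inf_{h ∈ H} sup_{T ∈ 𝒯} err(h, T(D))`. -/
def optInf {X : Type*} [MeasurableSpace X] (D : Measure (X × Label)) (H : Set (X → Label))
    (𝒯 : Set (X → X)) : ℝ :=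
  ⨅ h : H, worstErr D 𝒯 h

/-- The empirical error `err(h, T(S)) = (1/m) ∑ i, 1[h (T x_i) ≠ y_i]` on the sample
`S = ((x_1, y_1), …, (x_m, y_m))`. -/
def empErr {X : Type*} {m : ℕ} (S : Fin m → X × Label) (h : X → Label) (T : X → X) : ℝ :=
  (1 / (m : ℝ)) * ∑ i, if h (T (S i).1) ≠ (S i).2 then 1 else 0

/-- The empirical worst-case error `max_{T ∈ 𝒯} err(h, T(S))`
(the empirical errors lie in `{0, 1/m, …, 1}`, so that the supremum is a maximum). -/
def empWorstErr {X : Type*} {m : ℕ} (S : Fin m → X × Label) (𝒯 : Set (X → X)) (h : X → Label) :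
    ℝ :=
  ⨆ T : 𝒯, empErr S h T

/-- The possible outputs of the empirical min-max rule on the sample `S`:
`argmin_{h ∈ H} max_{T ∈ 𝒯} err(h, T(S))`. -/
def minMaxRule {X : Type*} {m : ℕ} (H : Set (X → Label)) (𝒯 : Set (X → X))
    (S : Fin m → X × Label) : Set (X → Label) :=
  {h | h ∈ H ∧ ∀ g ∈ H, empWorstErr S 𝒯 h ≤ empWorstErr S 𝒯 g}

/-- The usual measurability conventions of uniform convergence over a possibly uncountable class:
every `h ∘ T` is measurable, and the largest deviation
`sup_{h, T} |err(h, T(S)) - err(h, T(S'))|` between the empirical errors on two independent samples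
`S, S' ∼ D^n` is a random variable (measurable with respect to the completion of `D^n × D^n`). -/
structure IsWellBehaved {X : Type*} [MeasurableSpace X] (D : Measure (X × Label))
    (H : Set (X → Label)) (𝒯 : Set (X → X)) : Prop where
  measurable_comp : ∀ h ∈ H, ∀ T ∈ 𝒯, Measurable (h ∘ T)
  measurable_sup : ∀ n : ℕ, NullMeasurable
    (fun p : (Fin n → X × Label) × (Fin n → X × Label) =>
      ⨆ q : H × 𝒯, |empErr p.1 q.1 q.2 - empErr p.2 q.1 q.2|)
    ((Measure.pi fun _ => D).prod (Measure.pi fun _ => D))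

end

open scoped ENNReal

/-! Both errors depend on `h` and `T` only through `h ∘ T`. If every empirical error over `H ∘ 𝒯` is
within `ε / 2` of the true one, then so are the worst-case errors, and minimising the empirical one
loses at most `ε`. It remains to prove uniform convergence at the rate `√((d + log (1/δ)) / m)`,
without a factor `log (1/ε)`.

A ghost sample replaces the true error by a second empirical error. Exchanging paired points of the
two samples preserves their law, so it suffices to bound, for each fixed double sample, the
proportion of sign vectors with a large signed count of some loss pattern
(`measure_le_of_forall_card_le`).

A union bound over all patterns would cost a logarithm. Instead, patterns are approximated at the
scales `4 ^ (-j)`. Nets at scale `η` have at most `2 (4/η) ^ (2d)` members (`Finset.exists_net`),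
and the increments are sub-Gaussian with variance proxy of order the scale
(`card_signedCount_sub_gt_le`). The entropy grows only linearly in `j` while the variance decays
geometrically, so the links sum to order `√((d + L) / m)`, where `exp (-L)` is the target
probability (`card_exists_signedCount_gt_le`). -/

/-! ### Sauer–Shelah, packing and covering numbers -/

theorem Finset.card_le_of_forall_shatters_card_le {α : Type*} [Fintype α] [DecidableEq α]
    {𝒜 : Finset (Finset α)} {d : ℕ} (h : ∀ s, 𝒜.Shatters s → s.card ≤ d) {x : ℝ} (hx0 : 0 < x)
    (hx1 : x ≤ 1) : (𝒜.card : ℝ) ≤ (x⁻¹) ^ d * Real.exp (x * Fintype.card α) := by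
  have h1 : (𝒜.card : ℝ) ≤ 𝒜.shatterer.card := by exact_mod_cast 𝒜.card_le_card_shatterer
  -- Each shattered set has weight `x ^ (|s| - d) ≥ 1`. Extending the sum to all subsets gives `(1 +
  -- x) ^ n ≤ exp (x n)` by the binomial theorem.
  have h2 : (𝒜.shatterer.card : ℝ) ≤ ∑ s ∈ 𝒜.shatterer, (x⁻¹) ^ d * x ^ s.card := by
    rw [Finset.card_eq_sum_ones, Nat.cast_sum]
    refine Finset.sum_le_sum fun s hs => ?_
    have hs' := h s (Finset.mem_shatterer.1 hs)
    have : x ^ d ≤ x ^ s.card := pow_le_pow_of_le_one hx0.le hx1 hs'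
    rw [inv_pow, Nat.cast_one, ← div_eq_inv_mul, le_div_iff₀ (by positivity)]
    linarith
  have h3 : ∑ s ∈ 𝒜.shatterer, (x⁻¹) ^ d * x ^ s.card ≤ ∑ s : Finset α, (x⁻¹) ^ d * x ^ s.card :=
    Finset.sum_le_sum_of_subset_of_nonneg (Finset.subset_univ _) fun _ _ _ => by positivity
  have h4 : ∑ s : Finset α, x ^ s.card = (x + 1) ^ Fintype.card α := by
    have := Fintype.sum_pow_mul_eq_add_pow α x 1
    simpa using this
  rw [← Finset.mul_sum Finset.univ, h4] at h3
  refine (h1.trans (h2.trans h3)).trans ?_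
  gcongr
  rw [mul_comm, Real.exp_nat_mul]
  gcongr
  exact Real.add_one_le_exp x

/-- The trace of a family along a map of index sets shatters no more than the family does. -/
theorem Finset.Shatters.of_comap {ι κ : Type*} [DecidableEq ι] [DecidableEq κ] [Fintype κ]
    {𝒜 : Finset (Finset ι)} {ω : κ → ι} {s : Finset κ}
    (h : (𝒜.image fun A => Finset.univ.filter fun i => ω i ∈ A).Shatters s) :
    𝒜.Shatters (s.image ω) ∧ (s.image ω).card = s.card := by
  have key : ∀ t ⊆ s, ∃ A ∈ 𝒜, ∀ i ∈ s, ω i ∈ A ↔ i ∈ t := by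
    intro t ht
    obtain ⟨u, hu, hut⟩ := h ht
    obtain ⟨A, hA, rfl⟩ := Finset.mem_image.1 hu
    refine ⟨A, hA, fun i hi => ?_⟩
    rw [← hut]
    simp [hi]
  constructor
  · intro t ht
    obtain ⟨A, hA, hAt⟩ := key (s.filter fun i => ω i ∈ t) (Finset.filter_subset _ _)
    refine ⟨A, hA, ?_⟩
    ext y
    simp only [Finset.mem_inter, Finset.mem_image]
    constructor
    · rintro ⟨⟨i, hi, rfl⟩, hy⟩
      exact (Finset.mem_filter.1 ((hAt i hi).1 hy)).2
    · intro hy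
      obtain ⟨i, hi, rfl⟩ := Finset.mem_image.1 (ht hy)
      exact ⟨⟨i, hi, rfl⟩, (hAt i hi).2 (Finset.mem_filter.2 ⟨hi, hy⟩)⟩
  · refine Finset.card_image_of_injOn fun i hi j hj hij => ?_
    obtain ⟨A, -, hA⟩ := key {i} (by simpa using hi)
    have h1 := (hA i hi).2 (by simp)
    rw [hij] at h1
    exact (Finset.mem_singleton.1 ((hA j hj).1 h1)).symm

/-- Probabilistic method: `k` uniform draws all miss a set of density above `η` with probability at
most `exp (-η k)`, and there are at most `|ℳ| ^ 2` pairs. The probabilities are counts of functions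
`Fin k → ι`. -/
theorem Finset.exists_separating_sample {ι : Type*} [Fintype ι] [DecidableEq ι] [Nonempty ι]
    {ℳ : Finset (Finset ι)} {η : ℝ}
    (hsep : ∀ A ∈ ℳ, ∀ B ∈ ℳ, A ≠ B → η * Fintype.card ι < (symmDiff A B).card) {k : ℕ}
    (hk : (ℳ.card : ℝ) ^ 2 * Real.exp (-(η * k)) < 1) :
    ∃ ω : Fin k → ι, ∀ A ∈ ℳ, ∀ B ∈ ℳ, A ≠ B → ∃ j, ω j ∈ symmDiff A B := by
  by_contra! hcon
  have hN : (0 : ℝ) < Fintype.card ι := by exact_mod_cast Fintype.card_pos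
  have hsub : (Finset.univ : Finset (Fin k → ι)) ⊆
      ℳ.offDiag.biUnion fun p => Fintype.piFinset fun _ => (symmDiff p.1 p.2)ᶜ := by
    intro ω _
    obtain ⟨A, hA, B, hB, hAB, h⟩ := hcon ω
    simp only [Finset.mem_biUnion]
    exact ⟨(A, B), Finset.mem_offDiag.2 ⟨hA, hB, hAB⟩,
      Fintype.mem_piFinset.2 fun j => Finset.mem_compl.2 (h j)⟩
  have h1 := (Finset.card_le_card hsub).trans Finset.card_biUnion_le
  have h2 : ∀ p ∈ ℳ.offDiag, ((Fintype.piFinset fun _ : Fin k => (symmDiff p.1 p.2)ᶜ).card : ℝ) ≤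
      (Fintype.card ι : ℝ) ^ k * Real.exp (-(η * k)) := by
    intro p hp
    obtain ⟨hA, hB, hAB⟩ := Finset.mem_offDiag.1 hp
    have h3 := hsep _ hA _ hB hAB
    have h4 : (((symmDiff p.1 p.2)ᶜ.card : ℕ) : ℝ) ≤ Fintype.card ι * Real.exp (-η) := by
      rw [Finset.card_compl, Nat.cast_sub (Finset.card_le_univ _)]
      have := Real.add_one_le_exp (-η)
      nlinarith
    rw [Fintype.card_piFinset, Finset.prod_const, Finset.card_univ, Fintype.card_fin,
      Nat.cast_pow]
    calc _ ≤ (Fintype.card ι * Real.exp (-η)) ^ k := by gcongr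
      _ = _ := by rw [mul_pow, ← Real.exp_nat_mul]; ring_nf
  have h5 : ((Fintype.card ι : ℝ)) ^ k ≤
      (ℳ.card : ℝ) ^ 2 * ((Fintype.card ι : ℝ) ^ k * Real.exp (-(η * k))) := by
    have h6 : (Fintype.card ι : ℝ) ^ k ≤ ∑ p ∈ ℳ.offDiag,
        ((Fintype.piFinset fun _ : Fin k => (symmDiff p.1 p.2)ᶜ).card : ℝ) := by
      rw [Finset.card_univ, Fintype.card_fun, Fintype.card_fin] at h1
      exact_mod_cast h1
    refine h6.trans ((Finset.sum_le_sum h2).trans ?_)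
    rw [Finset.sum_const, nsmul_eq_mul]
    gcongr
    rw [Finset.offDiag_card]
    exact_mod_cast (Nat.sub_le _ _).trans (by rw [sq])
  have : (0 : ℝ) < (Fintype.card ι : ℝ) ^ k := by positivity
  nlinarith

/-- Polynomial bound on the packing numbers of a family of bounded VC dimension. -/
theorem Finset.card_le_of_separated {ι : Type*} [Fintype ι] [DecidableEq ι] [Nonempty ι]
    {ℳ : Finset (Finset ι)} {d : ℕ} (hd : ∀ s, ℳ.Shatters s → s.card ≤ d) {η : ℝ} (hη0 : 0 < η)
    (hη1 : η ≤ 1)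
    (hsep : ∀ A ∈ ℳ, ∀ B ∈ ℳ, A ≠ B → η * Fintype.card ι < (symmDiff A B).card) :
    (ℳ.card : ℝ) ≤ 2 * ((4 / η) ^ d) ^ 2 := by
  rcases ℳ.eq_empty_or_nonempty with rfl | hne
  · simp; positivity
  have hM : (1 : ℝ) ≤ ℳ.card := by exact_mod_cast hne.card_pos
  set M : ℝ := (ℳ.card : ℝ) with hMdef
  -- Just large enough for `M ^ 2 * exp (-η k) < 1`.
  set k : ℕ := ⌊2 * Real.log M / η⌋₊ + 1 with hkdef
  have hL : 0 ≤ Real.log M := Real.log_nonneg hM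
  have hk1 : 2 * Real.log M < η * k := by
    have := Nat.lt_floor_add_one (2 * Real.log M / η)
    rw [div_lt_iff₀ hη0] at this
    push_cast [hkdef]; linarith
  have hk2 : η * k ≤ 2 * Real.log M + η := by
    have := Nat.floor_le (show 0 ≤ 2 * Real.log M / η by positivity)
    rw [le_div_iff₀ hη0] at this
    push_cast [hkdef]; linarith
  have hexp : M = Real.exp (Real.log M) := (Real.exp_log (by linarith)).symm
  obtain ⟨ω, hω⟩ := Finset.exists_separating_sample hsep (k := k) (by
    rw [← hMdef, hexp, ← Real.exp_nat_mul, ← Real.exp_add, Real.exp_lt_one_iff]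
    push_cast; linarith)
  have hinj : Set.InjOn (fun A : Finset ι => Finset.univ.filter fun i => ω i ∈ A)
      (ℳ : Set (Finset ι)) := by
    intro A hA B hB hAB
    by_contra hne
    obtain ⟨j, hj⟩ := hω A hA B hB hne
    have : ω j ∈ A ↔ ω j ∈ B := by simpa using Finset.ext_iff.1 hAB j
    rw [Finset.mem_symmDiff] at hj
    tauto
  -- The traces on the sample are distinct, so Sauer–Shelah bounds `M` itself. With `x = η / 4` the
  -- exponent `x k` is at most `log M / 2 + 1 / 4`, so `M ≤ Q √M exp (1/4)`, which bounds `M`.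
  have hcard := Finset.card_le_of_forall_shatters_card_le
    (𝒜 := ℳ.image fun A : Finset ι => Finset.univ.filter fun i => ω i ∈ A) (d := d)
    (fun s hs => by
      obtain ⟨h1, h2⟩ := hs.of_comap
      exact h2 ▸ hd _ h1) (x := η / 4) (by positivity) (by linarith)
  rw [Finset.card_image_of_injOn hinj, ← hMdef, Fintype.card_fin, inv_div] at hcard
  set Q : ℝ := (4 / η) ^ d
  have hQ : 0 < Q := by positivity
  have h1 : M ≤ Q * Real.exp (Real.log M / 2 + 1 / 4) :=
    hcard.trans (by gcongr; linarith)
  set R := Real.exp (Real.log M / 2) with hR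
  have hRR : M = R * R := by rw [hR, ← Real.exp_add, add_halves, ← hexp]
  have hRpos : 0 < R := Real.exp_pos _
  rw [Real.exp_add, ← hR] at h1
  have h2 : R ≤ Q * Real.exp (1 / 4) := by
    have : R * R ≤ R * (Q * Real.exp (1 / 4)) := by linarith
    exact le_of_mul_le_mul_left this hRpos
  have h3 : Real.exp (1 / 4) ^ 2 ≤ 2 := by
    have h4 : (Real.exp (1 / 4) ^ 2) ^ 2 = Real.exp 1 := by
      rw [← pow_mul, ← Real.exp_nat_mul]; norm_num
    have := Real.exp_one_lt_d9
    nlinarith [sq_nonneg (Real.exp (1 / 4))]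
  calc M = R ^ 2 := by rw [hRR, sq]
    _ ≤ (Q * Real.exp (1 / 4)) ^ 2 := by gcongr
    _ = Q ^ 2 * Real.exp (1 / 4) ^ 2 := by ring
    _ ≤ Q ^ 2 * 2 := by gcongr
    _ = _ := by ring

/-- Polynomial bound on the covering numbers of a family of bounded VC dimension. -/
theorem Finset.exists_net {ι : Type*} [Fintype ι] [DecidableEq ι] [Nonempty ι]
    {𝒜 : Finset (Finset ι)} {d : ℕ} (hd : ∀ s, 𝒜.Shatters s → s.card ≤ d) {η : ℝ} (hη0 : 0 < η)
    (hη1 : η ≤ 1) :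
    ∃ 𝒩 ⊆ 𝒜, (𝒩.card : ℝ) ≤ 2 * ((4 / η) ^ d) ^ 2 ∧
      ∀ A ∈ 𝒜, ∃ B ∈ 𝒩, ((symmDiff A B).card : ℝ) ≤ η * Fintype.card ι := by
  classical
  -- A separated subfamily of maximal size is a net: a set far from all its members could be added
  -- to it.
  obtain ⟨𝒩, h𝒩, hmax⟩ := Finset.exists_max_image
    (𝒜.powerset.filter fun ℳ => ∀ A ∈ ℳ, ∀ B ∈ ℳ, A ≠ B →
      η * Fintype.card ι < (symmDiff A B).card) Finset.card ⟨∅, by simp⟩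
  simp only [Finset.mem_filter, Finset.mem_powerset] at h𝒩 hmax
  refine ⟨𝒩, h𝒩.1, Finset.card_le_of_separated (fun s hs => hd s (hs.mono_left h𝒩.1)) hη0 hη1
    h𝒩.2, fun A hA => ?_⟩
  by_contra! hcon
  have hA𝒩 : A ∉ 𝒩 := fun h => by
    have := hcon A h
    simp only [symmDiff_self, Finset.bot_eq_empty, Finset.card_empty, Nat.cast_zero] at this
    have : 0 ≤ η * Fintype.card ι := by positivity
    linarith
  have := hmax (insert A 𝒩) ⟨Finset.insert_subset hA h𝒩.1, by
    intro B hB C hC hBC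
    rcases Finset.mem_insert.1 hB with hB' | hB' <;> rcases Finset.mem_insert.1 hC with hC' | hC'
    · exact absurd (hB'.trans hC'.symm) hBC
    · exact hB' ▸ hcon C hC'
    · rw [symmDiff_comm]; exact hC' ▸ hcon B hB'
    · exact h𝒩.2 B hB' C hC' hBC⟩
  rw [Finset.card_insert_of_notMem hA𝒩] at this
  omega

/-! ### Sub-Gaussian tails for random signs -/

/-- The Rademacher sign attached to a bit. -/
noncomputable def rademacherSign (b : Bool) : ℝ := if b then -1 else 1

/-- The exponential moment factors over the signs, and each factor is `2 cosh (c a_i) ≤ 2 exp ((c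
a_i) ^ 2 / 2)`. -/
theorem sum_exp_rademacher_le {κ : Type*} [Fintype κ] [DecidableEq κ] (a : κ → ℝ) (c : ℝ) :
    ∑ σ : κ → Bool, Real.exp (c * ∑ i, rademacherSign (σ i) * a i) ≤
      2 ^ Fintype.card κ * Real.exp (c ^ 2 * (∑ i, a i ^ 2) / 2) := by
  have h1 : ∀ σ : κ → Bool, Real.exp (c * ∑ i, rademacherSign (σ i) * a i) =
      ∏ i, Real.exp (c * (rademacherSign (σ i) * a i)) := fun σ => by
    rw [← Real.exp_sum, Finset.mul_sum]
  have h2 := Finset.prod_univ_sum (fun _ : κ => (Finset.univ : Finset Bool))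
    (fun i b => Real.exp (c * (rademacherSign b * a i)))
  rw [Fintype.piFinset_univ] at h2
  simp only [h1]
  rw [← h2]
  calc ∏ i, ∑ b : Bool, Real.exp (c * (rademacherSign b * a i))
      ≤ ∏ i, (2 * Real.exp ((c * a i) ^ 2 / 2)) := by
        refine Finset.prod_le_prod (fun i _ => Finset.sum_nonneg fun _ _ => (Real.exp_pos _).le)
          fun i _ => ?_
        have := Real.cosh_le_exp_half_sq (c * a i)
        rw [Real.cosh_eq] at this
        simp only [Fintype.sum_bool, rademacherSign]
        simp only [if_true, Bool.false_eq_true, if_false, one_mul, neg_mul, mul_neg]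
        linarith
    _ = _ := by
        rw [Finset.prod_mul_distrib, Finset.prod_const, Finset.card_univ, ← Real.exp_sum,
          Finset.mul_sum, Finset.sum_div]
        simp only [mul_pow]

theorem card_rademacher_gt_le {κ : Type*} [Fintype κ] [DecidableEq κ] (a : κ → ℝ) {V t : ℝ}
    (hV : 0 < V) (haV : ∑ i, a i ^ 2 ≤ V) (ht : 0 ≤ t) :
    ((Finset.univ.filter fun σ : κ → Bool => t < ∑ i, rademacherSign (σ i) * a i).card : ℝ) ≤
      2 ^ Fintype.card κ * Real.exp (-(t ^ 2 / (2 * V))) := by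
  set E := Finset.univ.filter fun σ : κ → Bool => t < ∑ i, rademacherSign (σ i) * a i
  -- Chernoff's method; this `c` minimises `c ^ 2 V / 2 - c t`.
  set c := t / V with hc
  have hc0 : 0 ≤ c := by positivity
  have h1 : (E.card : ℝ) * Real.exp (c * t) ≤
      ∑ σ : κ → Bool, Real.exp (c * ∑ i, rademacherSign (σ i) * a i) := by
    rw [← nsmul_eq_mul, ← Finset.sum_const]
    refine (Finset.sum_le_sum fun σ hσ => ?_).trans
      (Finset.sum_le_sum_of_subset_of_nonneg (Finset.subset_univ E)
        fun _ _ _ => (Real.exp_pos _).le)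
    have := (Finset.mem_filter.1 hσ).2
    gcongr
  have h2 := h1.trans (sum_exp_rademacher_le a c)
  have h3 : (E.card : ℝ) * Real.exp (c * t) ≤
      2 ^ Fintype.card κ * Real.exp (c ^ 2 * V / 2) := h2.trans (by gcongr)
  have h4 : -(t ^ 2 / (2 * V)) = c ^ 2 * V / 2 - c * t := by
    rw [hc]; field_simp; ring
  rw [h4, Real.exp_sub, ← mul_div_assoc, le_div_iff₀ (Real.exp_pos _)]
  exact h3

/-- Hoeffding's inequality for Rademacher sums. -/
theorem card_rademacher_abs_gt_le {κ : Type*} [Fintype κ] [DecidableEq κ] (a : κ → ℝ) {V t : ℝ}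
    (hV : 0 < V) (haV : ∑ i, a i ^ 2 ≤ V) (ht : 0 ≤ t) :
    ((Finset.univ.filter fun σ : κ → Bool => t < |∑ i, rademacherSign (σ i) * a i|).card : ℝ) ≤
      2 ^ Fintype.card κ * (2 * Real.exp (-(t ^ 2 / (2 * V)))) := by
  have h1 := card_rademacher_gt_le a hV haV ht
  have h2 := card_rademacher_gt_le (fun i => -a i) hV (by simpa using haV) ht
  have h3 : (Finset.univ.filter fun σ : κ → Bool => t < |∑ i, rademacherSign (σ i) * a i|) ⊆
      (Finset.univ.filter fun σ : κ → Bool => t < ∑ i, rademacherSign (σ i) * a i) ∪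
      (Finset.univ.filter fun σ : κ → Bool => t < ∑ i, rademacherSign (σ i) * -a i) := by
    intro σ
    simp only [Finset.mem_filter, Finset.mem_univ, true_and, Finset.mem_union, lt_abs, mul_neg,
      Finset.sum_neg_distrib, imp_self]
  have h4 : ((Finset.univ.filter fun σ : κ → Bool =>
      t < |∑ i, rademacherSign (σ i) * a i|).card : ℝ) ≤ _ :=
    Nat.cast_le.2 ((Finset.card_le_card h3).trans (Finset.card_union_le _ _))
  push_cast at h4
  linarith

/-- The symmetrised count of `A ⊆ κ × Bool`: the difference between the two halves of `A`, with
random signs. -/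
noncomputable def signedCount {κ : Type*} [Fintype κ] [DecidableEq κ] (σ : κ → Bool) (A : Finset (κ × Bool)) :
    ℝ :=
  ∑ i, rademacherSign (σ i) *
    ((if (i, false) ∈ A then 1 else 0) - (if (i, true) ∈ A then 1 else 0))

theorem signedCount_empty {κ : Type*} [Fintype κ] [DecidableEq κ] (σ : κ → Bool) :
    signedCount σ ∅ = 0 := by
  simp [signedCount]

/-- The symmetrised counts have sub-Gaussian increments. -/
theorem card_signedCount_sub_gt_le {κ : Type*} [Fintype κ] [DecidableEq κ]
    (A B : Finset (κ × Bool)) {V t : ℝ} (hV : 0 < V) (hAB : ((symmDiff A B).card : ℝ) ≤ V)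
    (ht : 0 ≤ t) :
    ((Finset.univ.filter fun σ : κ → Bool => t < |signedCount σ A - signedCount σ B|).card : ℝ) ≤
      2 ^ Fintype.card κ * (2 * Real.exp (-(t ^ 2 / (4 * V)))) := by
  let χ : Finset (κ × Bool) → κ × Bool → ℝ := fun A p => if p ∈ A then 1 else 0
  have hχ : ∀ p, (χ A p - χ B p) ^ 2 = χ (symmDiff A B) p := by
    intro p
    simp only [χ, Finset.mem_symmDiff]
    by_cases h1 : p ∈ A <;> by_cases h2 : p ∈ B <;> simp [h1, h2]
  have hsum : ∑ i, (χ (symmDiff A B) (i, true) + χ (symmDiff A B) (i, false)) =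
      (symmDiff A B).card := by
    have : ∑ p, χ (symmDiff A B) p = (symmDiff A B).card := by
      simp [χ]
    rw [← this, Fintype.sum_prod_type]
    simp
  -- The factor 2 comes from `(u - v) ^ 2 ≤ 2 (u ^ 2 + v ^ 2)`, since one sign governs both halves
  -- of a pair.
  have key := card_rademacher_abs_gt_le
    (fun i => (χ A (i, false) - χ A (i, true)) - (χ B (i, false) - χ B (i, true)))
    (V := 2 * V) (by positivity) (by
      calc _ ≤ ∑ i, 2 * (χ (symmDiff A B) (i, true) + χ (symmDiff A B) (i, false)) := by
            refine Finset.sum_le_sum fun i _ => ?_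
            rw [← hχ, ← hχ]
            nlinarith [sq_nonneg ((χ A (i, false) - χ B (i, false)) +
              (χ A (i, true) - χ B (i, true)))]
        _ ≤ 2 * V := by rw [← Finset.mul_sum, hsum]; linarith) ht
  convert key using 6
  · simp only [signedCount, χ, ← Finset.sum_sub_distrib, mul_sub]
  · ring

/-! ### Chaining -/

theorem sum_add_two_mul_half_pow (J : ℕ) :
    ∑ j ∈ Finset.range J, ((j : ℝ) + 2) * (1 / 2) ^ j = 6 - (2 * J + 6) * (1 / 2) ^ J := by
  induction J with
  | zero => norm_num
  | succ J ih => rw [Finset.sum_range_succ, ih]; push_cast; ring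

theorem sum_half_pow_add_two (J : ℕ) :
    ∑ j ∈ Finset.range J, (1 / 2 : ℝ) ^ (j + 2) = 1 / 2 - (1 / 2) ^ (J + 1) := by
  induction J with
  | zero => norm_num
  | succ J ih => rw [Finset.sum_range_succ, ih]; ring

/-- The union bound at one link of the chain: entropy against the sub-Gaussian tail. -/
theorem chaining_link_bound {N d L s : ℝ} {j : ℕ} (hd : 0 ≤ d) (hL : Real.log 2 ≤ L)
    (hN : N ≤ 2 * Real.exp (3 * (j + 2) * d)) (hs : 3 * (j + 2) ^ 2 * (d + L) ≤ s) :
    N * (2 * Real.exp (-s)) ≤ Real.exp (-L) * (1 / 2) ^ (j + 2) := by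
  have hl : 0 < Real.log 2 := Real.log_pos one_lt_two
  have hj : (0 : ℝ) ≤ j := j.cast_nonneg
  have h1 : N * (2 * Real.exp (-s)) ≤ 4 * Real.exp (3 * (j + 2) * d - s) := by
    calc _ ≤ (2 * Real.exp (3 * (j + 2) * d)) * (2 * Real.exp (-s)) := by gcongr
      _ = _ := by rw [sub_eq_add_neg, Real.exp_add]; ring
  -- The `d` part of `s` absorbs the entropy. The `L` part pays for `exp (-L)` and for `2 ^ (-(j +
  -- 4))`, of which the prefactor 4 leaves `2 ^ (-(j + 2))`.
  have h2 : 3 * (j + 2) * d - s ≤ -L - (j + 4 : ℕ) * Real.log 2 := by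
    have h3 : 3 * (j + 2) * d ≤ 3 * (j + 2) ^ 2 * d := by
      gcongr 3 * ?_ * d
      nlinarith
    have h4 : L + (j + 4) * L ≤ 3 * (j + 2) ^ 2 * L := by
      have : (0 : ℝ) ≤ 3 * (j + 2) ^ 2 - (j + 5) := by nlinarith
      nlinarith
    have h5 : ((j : ℝ) + 4) * Real.log 2 ≤ (j + 4) * L := by gcongr
    push_cast
    linarith
  refine h1.trans ?_
  calc 4 * Real.exp (3 * (j + 2) * d - s)
      ≤ 4 * Real.exp (-L - (j + 4 : ℕ) * Real.log 2) := by gcongr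
    _ = Real.exp (-L) * (1 / 2) ^ (j + 2) := by
      rw [Real.exp_sub, Real.exp_nat_mul, Real.exp_log two_pos, one_div, inv_pow]
      field_simp
      ring

/-- Chaining: the symmetrised counts over a family of VC dimension at most `d` are uniformly
small for most choices of signs. -/
theorem card_exists_signedCount_gt_le {κ : Type*} [Fintype κ] [DecidableEq κ] [Nonempty κ]
    {𝒜 : Finset (Finset (κ × Bool))} {d : ℕ} (hd : ∀ s, 𝒜.Shatters s → s.card ≤ d) {ε L : ℝ}
    (hε : 0 < ε) (hL : Real.log 2 ≤ L) (hn : 13824 * (d + L) ≤ Fintype.card κ * ε ^ 2) :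
    ((Finset.univ.filter fun σ : κ → Bool =>
      ∃ A ∈ 𝒜, Fintype.card κ * ε / 4 < |signedCount σ A|).card : ℝ) ≤
      2 ^ Fintype.card κ * (Real.exp (-L) / 2) := by
  classical
  have hn0 : (0 : ℝ) < Fintype.card κ := by exact_mod_cast Fintype.card_pos
  set n : ℝ := (Fintype.card κ : ℝ) with hndef
  have hcardι : (Fintype.card (κ × Bool) : ℝ) = 2 * n := by
    rw [Fintype.card_prod, Fintype.card_bool]; push_cast; ring
  have hnet := fun j : ℕ => Finset.exists_net hd (η := (1 / 4) ^ j) (by positivity)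
    (pow_le_one₀ (by norm_num) (by norm_num))
  choose 𝒩 hsub hcard hcov using hnet
  choose! π hπ𝒩 hπdist using hcov
  -- Every chain starts at `∅`, whose signed count is 0 and which is within the trivial distance `2
  -- n` of any set.
  let ρ : ℕ → Finset (κ × Bool) → Finset (κ × Bool) := fun j A => if j = 0 then ∅ else π j A
  have hρdist : ∀ j, ∀ A ∈ 𝒜, ((symmDiff A (ρ j A)).card : ℝ) ≤ (1 / 4) ^ j * (2 * n) := by
    intro j A hA
    rw [← hcardι]
    by_cases hj : j = 0
    · simp only [ρ, hj, if_true, pow_zero, one_mul]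
      exact_mod_cast Finset.card_le_univ _
    · simp only [ρ, hj, if_false]
      exact hπdist j A hA
  -- The factor `2 ^ (-j)` is the standard deviation at scale `4 ^ (-j)`, and `j + 2` pays for the
  -- entropy. The weights sum to less than 6, so the thresholds stay below `n ε / 4` in total.
  let t : ℕ → ℝ := fun j => n * ε / 24 * ((j + 2) * (1 / 2) ^ j)
  have ht0 : ∀ j, 0 ≤ t j := fun j => by positivity
  -- A link is determined by its finer end `B`, because the coarser end is `ρ j B`. Hence only the
  -- size of `𝒩 (j + 1)` enters the union bound.
  let E : ℕ → Finset (κ → Bool) := fun j => (𝒩 (j + 1)).biUnion fun B =>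
    Finset.univ.filter fun σ => t j < |signedCount σ B - signedCount σ (ρ j B)|
  have hE : ∀ j, ((E j).card : ℝ) ≤
      2 ^ Fintype.card κ * (Real.exp (-L) * (1 / 2) ^ (j + 2)) := by
    intro j
    have h1 : ((E j).card : ℝ) ≤ ∑ B ∈ 𝒩 (j + 1), ((Finset.univ.filter fun σ : κ → Bool =>
        t j < |signedCount σ B - signedCount σ (ρ j B)|).card : ℝ) := by
      exact_mod_cast Finset.card_biUnion_le
    have h2 := Finset.sum_le_sum fun B (hB : B ∈ 𝒩 (j + 1)) =>
      card_signedCount_sub_gt_le B (ρ j B) (V := (1 / 4) ^ j * (2 * n)) (by positivity)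
        (hρdist j B (hsub _ hB)) (ht0 j)
    rw [Finset.sum_const, nsmul_eq_mul] at h2
    refine h1.trans (h2.trans ?_)
    rw [mul_left_comm]
    refine mul_le_mul_of_nonneg_left ?_ (by positivity)
    refine chaining_link_bound d.cast_nonneg hL ?_ ?_
    · refine (hcard (j + 1)).trans ?_
      gcongr
      have h3 : (4 / (1 / 4) ^ (j + 1) : ℝ) = 4 ^ (j + 2) := by
        rw [one_div, inv_pow, div_inv_eq_mul]; ring
      have h4 : (16 : ℝ) ≤ Real.exp 3 := by
        have h5 := Real.exp_one_gt_d9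
        have : Real.exp 3 = Real.exp 1 ^ 3 := by rw [← Real.exp_nat_mul]; norm_num
        rw [this]
        calc (16 : ℝ) ≤ 2.7 ^ 3 := by norm_num
          _ ≤ _ := by gcongr; linarith
      calc ((4 / (1 / 4) ^ (j + 1) : ℝ) ^ d) ^ 2 = 16 ^ ((j + 2) * d) := by
            rw [h3, show (16 : ℝ) = 4 ^ 2 by norm_num, ← pow_mul, ← pow_mul, ← pow_mul]
            congr 1
            ring
        _ ≤ Real.exp 3 ^ ((j + 2) * d) := by gcongr
        _ = _ := by rw [← Real.exp_nat_mul]; push_cast; ring_nf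
    · have h6 : t j ^ 2 / (4 * ((1 / 4) ^ j * (2 * n))) = n * ε ^ 2 * (j + 2) ^ 2 / 4608 := by
        have h7 : (((1 : ℝ) / 2) ^ j) ^ 2 = (1 / 4) ^ j := by
          rw [← pow_mul, mul_comm, pow_mul]; norm_num
        have h8 : (0 : ℝ) < (1 / 4) ^ j := by positivity
        simp only [t, mul_pow, h7]
        field_simp
        ring
      rw [h6]
      have : (0 : ℝ) ≤ ((j : ℝ) + 2) ^ 2 := by positivity
      nlinarith
  -- At this scale the distance is below 1, so the chain ends at `A` itself.
  obtain ⟨J, hJ⟩ := exists_pow_lt_of_lt_one (show 0 < 1 / (2 * n) by positivity)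
    (show (1 / 4 : ℝ) < 1 by norm_num)
  rw [lt_div_iff₀ (by positivity)] at hJ
  have hsubset : (Finset.univ.filter fun σ : κ → Bool =>
      ∃ A ∈ 𝒜, n * ε / 4 < |signedCount σ A|) ⊆ (Finset.range J).biUnion E := by
    intro σ hσ
    by_contra hcon
    obtain ⟨A, hA, hlt⟩ := (Finset.mem_filter.1 hσ).2
    have hlink : ∀ j < J, ∀ B ∈ 𝒩 (j + 1),
        |signedCount σ B - signedCount σ (ρ j B)| ≤ t j := by
      simpa [E] using hcon
    -- The chain is followed backwards: the predecessor of `ρ (j + 1) A` is its own approximation,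
    -- not `ρ j A`.
    have hchain : ∀ j ≤ J, ∀ A ∈ 𝒜, |signedCount σ (ρ j A)| ≤ ∑ i ∈ Finset.range j, t i := by
      intro j
      induction j with
      | zero => intro _ A _; simp [ρ, signedCount_empty]
      | succ j ih =>
        intro hj A hA
        have hB : ρ (j + 1) A ∈ 𝒩 (j + 1) := by simpa [ρ] using hπ𝒩 (j + 1) A hA
        have h1 := hlink j hj _ hB
        have h2 := ih (by omega) _ (hsub _ hB)
        rw [Finset.sum_range_succ]
        have h3 := abs_add_le (signedCount σ (ρ (j + 1) A) - signedCount σ (ρ j (ρ (j + 1) A)))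
          (signedCount σ (ρ j (ρ (j + 1) A)))
        rw [sub_add_cancel] at h3
        linarith
    have hAJ : ρ J A = A := by
      have h1 := (hρdist J A hA).trans_lt hJ
      have h2 : (symmDiff A (ρ J A)).card = 0 := by
        have : (symmDiff A (ρ J A)).card < 1 := by exact_mod_cast h1
        omega
      exact (symmDiff_eq_bot.1 (Finset.card_eq_zero.1 h2)).symm
    have h3 := hchain J le_rfl A hA
    rw [hAJ, ← Finset.mul_sum, sum_add_two_mul_half_pow] at h3
    have h4 : (0 : ℝ) ≤ (2 * J + 6) * (1 / 2) ^ J := by positivity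
    have h5 : 0 ≤ n * ε / 24 := by positivity
    nlinarith
  have h1 : ((Finset.univ.filter fun σ : κ → Bool =>
      ∃ A ∈ 𝒜, n * ε / 4 < |signedCount σ A|).card : ℝ) ≤
      ∑ j ∈ Finset.range J, ((E j).card : ℝ) := by
    exact_mod_cast (Finset.card_le_card hsubset).trans Finset.card_biUnion_le
  refine h1.trans ((Finset.sum_le_sum fun j _ => hE j).trans ?_)
  rw [← Finset.mul_sum, ← Finset.mul_sum, sum_half_pow_add_two]
  have : (0 : ℝ) ≤ (1 / 2) ^ (J + 1) := by positivity
  rw [div_eq_mul_one_div (Real.exp (-L)) 2]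
  gcongr
  linarith

/-! ### Loss patterns and the VC dimension -/

theorem Label.eq_of_ne_iff_ne {a b c : Label} (h : a ≠ c ↔ b ≠ c) : a = b := by
  rcases Int.units_eq_one_or a with rfl | rfl <;> rcases Int.units_eq_one_or b with rfl | rfl <;>
    rcases Int.units_eq_one_or c with rfl | rfl <;> revert h <;> decide

/-- The family of loss patterns of a class of predictors on labelled points. -/
noncomputable def lossPatterns {X ι : Type*} [Fintype ι] [DecidableEq ι] (F : Set (X → Label))
    (z : ι → X × Label) : Finset (Finset ι) :=
  open Classical in
  Finset.univ.filter fun A => ∃ f ∈ F, ∀ i, i ∈ A ↔ f (z i).1 ≠ (z i).2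

theorem mem_lossPatterns {X ι : Type*} [Fintype ι] [DecidableEq ι] {F : Set (X → Label)}
    {z : ι → X × Label} {A : Finset ι} :
    A ∈ lossPatterns F z ↔ ∃ f ∈ F, ∀ i, i ∈ A ↔ f (z i).1 ≠ (z i).2 := by
  simp [lossPatterns]

/-- The loss patterns shatter no set larger than the VC dimension of the class. -/
theorem card_le_vc_of_shatters_lossPatterns {X ι : Type*} [Fintype ι] [DecidableEq ι]
    {F : Set (X → Label)} {z : ι → X × Label} {s : Finset ι} (hs : (lossPatterns F z).Shatters s) :
    (s.card : ℕ∞) ≤ vc F := by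
  classical
  -- With two labels, erring exactly where `t` disagrees with the sample labels means agreeing with
  -- `t`.
  have key : ∀ t : ι → Label, ∃ f ∈ F, ∀ i ∈ s, f (z i).1 = t i := by
    intro t
    obtain ⟨A, hA, hAs⟩ := hs (s.filter_subset fun i => t i ≠ (z i).2)
    obtain ⟨f, hf, hfA⟩ := mem_lossPatterns.1 hA
    refine ⟨f, hf, fun i hi => Label.eq_of_ne_iff_ne (c := (z i).2) ?_⟩
    rw [← hfA]
    have := Finset.ext_iff.1 hAs i
    simpa [hi] using this
  -- Two indices carrying the same point could not receive opposite labels, so repetitions in the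
  -- sample do not inflate `s`.
  have hinj : Set.InjOn (fun i => (z i).1) (s : Set ι) := by
    intro i hi j hj hij
    by_contra hne
    obtain ⟨f, -, hf⟩ := key fun k => if k = i then 1 else -1
    have h1 := hf i hi
    have h2 := hf j hj
    simp only [if_true, if_neg (Ne.symm hne)] at h1 h2
    simp only at hij
    rw [hij, h2] at h1
    exact absurd h1 (by decide)
  rw [← Finset.card_image_of_injOn hinj]
  refine le_iSup₂_of_le (s.image fun i => (z i).1) (fun y => ?_) le_rfl
  obtain ⟨f, hf, hft⟩ := key fun i => y (z i).1
  refine ⟨f, hf, fun x hx => ?_⟩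
  obtain ⟨i, hi, rfl⟩ := Finset.mem_image.1 hx
  exact hft i hi

/-! ### Symmetrisation by exchanging two samples -/

/-- Exchange the `i`-th points of two samples for all `i` with `σ i = true`. -/
def exchange {κ Z : Type*} (σ : κ → Bool) (p : (κ → Z) × (κ → Z)) : (κ → Z) × (κ → Z) :=
  (fun i => if σ i then p.2 i else p.1 i, fun i => if σ i then p.1 i else p.2 i)

/-- Regarded as a sequence of independent pairs, the double sample has each pair swapped or left
alone, and both maps preserve `D.prod D`. -/
theorem measurePreserving_exchange {κ Z : Type*} [Fintype κ] [MeasurableSpace Z] (D : Measure Z)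
    [IsProbabilityMeasure D] (σ : κ → Bool) :
    MeasurePreserving (exchange σ) ((Measure.pi fun _ : κ => D).prod (Measure.pi fun _ : κ => D))
      ((Measure.pi fun _ : κ => D).prod (Measure.pi fun _ : κ => D)) := by
  have e := measurePreserving_arrowProdEquivProdArrow Z Z κ (fun _ => D) (fun _ => D)
  have hswap : ∀ b : Bool, MeasurePreserving
      (fun p : Z × Z => if b then p.swap else p) (D.prod D) (D.prod D) := by
    intro b
    cases b
    · simpa using! MeasurePreserving.id (D.prod D)
    · simpa using! (Measure.measurePreserving_swap (μ := D) (ν := D))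
  have hpi := measurePreserving_pi (fun _ : κ => D.prod D) (fun _ : κ => D.prod D)
    (fun i => hswap (σ i))
  have := (e.comp hpi).comp (e.symm _)
  convert! this using 1
  ext p i
  · cases h : σ i <;> simp [exchange, h, MeasurableEquiv.arrowProdEquivProdArrow,
      Equiv.arrowProdEquivProdArrow]
  · cases h : σ i <;> simp [exchange, h, MeasurableEquiv.arrowProdEquivProdArrow,
      Equiv.arrowProdEquivProdArrow]

/-- A set invariant in law under a finite collection of maps has measure at most the largest
proportion of the maps that send a given point into it. -/
theorem measure_le_of_forall_card_le {Ω Γ : Type*} [MeasurableSpace Ω] [Fintype Γ] [Nonempty Γ]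
    {μ : Measure Ω} [IsProbabilityMeasure μ] {g : Γ → Ω → Ω}
    (hg : ∀ γ, MeasurePreserving (g γ) μ μ) {A : Set Ω} (hA : NullMeasurableSet A μ) {c : ℝ}
    (hc : ∀ ω, ∃ s : Finset Γ, (∀ γ, g γ ω ∈ A → γ ∈ s) ∧ (s.card : ℝ) ≤ Fintype.card Γ * c) :
    μ A ≤ ENNReal.ofReal c := by
  have hpre : ∀ γ, NullMeasurableSet (g γ ⁻¹' A) μ := fun γ =>
    hA.preimage (hg γ).quasiMeasurePreserving
  have h1 : ∀ γ, ∫⁻ ω, (g γ ⁻¹' A).indicator 1 ω ∂μ = μ A := fun γ => by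
    rw [lintegral_indicator_one₀ (hpre γ), (hg γ).measure_preimage hA]
  -- All the preimages have measure `μ A`, so their indicators can be averaged over `Γ` before
  -- integrating.
  have h2 : (Fintype.card Γ : ℝ≥0∞) * μ A =
      ∫⁻ ω, ∑ γ, (g γ ⁻¹' A).indicator (1 : Ω → ℝ≥0∞) ω ∂μ := by
    have h3 : ∀ γ ∈ Finset.univ,
        AEMeasurable ((g γ ⁻¹' A).indicator (1 : Ω → ℝ≥0∞)) μ :=
      fun γ _ => aemeasurable_one.indicator₀ (hpre γ)
    rw [lintegral_finsetSum' _ h3]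
    simp only [h1, Finset.sum_const, Finset.card_univ, nsmul_eq_mul]
  have h3 : ∀ ω, ∑ γ, (g γ ⁻¹' A).indicator (1 : Ω → ℝ≥0∞) ω ≤
      Fintype.card Γ * ENNReal.ofReal c := by
    intro ω
    classical
    obtain ⟨s, hs, hsc⟩ := hc ω
    calc ∑ γ, (g γ ⁻¹' A).indicator (1 : Ω → ℝ≥0∞) ω
        ≤ ∑ γ, if γ ∈ s then (1 : ℝ≥0∞) else 0 := by
          refine Finset.sum_le_sum fun γ _ => ?_
          by_cases hγ : g γ ω ∈ A
          · simp [hγ, hs γ hγ]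
          · simp [hγ]
      _ = ENNReal.ofReal s.card := by simp
      _ ≤ ENNReal.ofReal (Fintype.card Γ * c) := ENNReal.ofReal_le_ofReal hsc
      _ = _ := by rw [ENNReal.ofReal_mul (by positivity), ENNReal.ofReal_natCast]
  have h4 : (Fintype.card Γ : ℝ≥0∞) * μ A ≤ Fintype.card Γ * ENNReal.ofReal c := by
    rw [h2]
    refine (lintegral_mono h3).trans ?_
    simp
  exact (ENNReal.mul_le_mul_iff_right (by simp) (by simp)).1 h4

/-- Exchanging the `i`-th pair flips the sign of its contribution, while the loss pattern `A` of the
unexchanged double sample stays fixed. -/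
theorem card_mul_empErr_exchange_sub {X : Type*} {m : ℕ} (σ : Fin m → Bool)
    (p : (Fin m → X × Label) × (Fin m → X × Label)) (h : X → Label) (T : X → X)
    {A : Finset (Fin m × Bool)}
    (hA : ∀ i, i ∈ A ↔ h (T ((if i.2 then p.2 i.1 else p.1 i.1)).1) ≠
      (if i.2 then p.2 i.1 else p.1 i.1).2) :
    m * (empErr (exchange σ p).1 h T - empErr (exchange σ p).2 h T) = signedCount σ A := by
  rcases Nat.eq_zero_or_pos m with rfl | hm
  · simp [signedCount]
  have hm' : (m : ℝ) ≠ 0 := by positivity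
  rw [empErr, empErr, ← mul_sub, ← mul_assoc, mul_one_div_cancel hm', one_mul,
    ← Finset.sum_sub_distrib, signedCount]
  refine Finset.sum_congr rfl fun i _ => ?_
  have h1 := hA (i, false)
  have h2 := hA (i, true)
  simp only [if_true, Bool.false_eq_true, if_false] at h1 h2
  cases hσ : σ i <;> simp only [exchange, hσ, h1, h2, rademacherSign] <;> simp

/-- Tail bound for the deviation between the empirical errors on two independent samples. -/
theorem measure_iSup_empErr_sub_gt_le {X : Type*} [MeasurableSpace X] {H : Set (X → Label)}
    {𝒯 : Set (X → X)} {D : Measure (X × Label)} [IsProbabilityMeasure D]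
    (hwb : IsWellBehaved D H 𝒯) {d : ℕ} (hd : vc (compClass H 𝒯) = d) {ε L : ℝ} (hε : 0 < ε)
    (hL : Real.log 2 ≤ L) {m : ℕ} (hm0 : 0 < m) (hm : 13824 * (d + L) ≤ m * ε ^ 2) :
    ((Measure.pi fun _ : Fin m => D).prod (Measure.pi fun _ : Fin m => D))
      {p | ε / 4 < ⨆ q : H × 𝒯, |empErr p.1 q.1 q.2 - empErr p.2 q.1 q.2|} ≤
      ENNReal.ofReal (Real.exp (-L) / 2) := by
  classical
  have : Nonempty (Fin m) := ⟨⟨0, hm0⟩⟩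
  refine measure_le_of_forall_card_le (g := exchange) (measurePreserving_exchange D)
    (hwb.measurable_sup m measurableSet_Ioi) fun p => ?_
  let z : Fin m × Bool → X × Label := fun i => if i.2 then p.2 i.1 else p.1 i.1
  have hshat : ∀ s, (lossPatterns (compClass H 𝒯) z).Shatters s → s.card ≤ d := fun s hs => by
    have := card_le_vc_of_shatters_lossPatterns hs
    rw [hd] at this
    exact_mod_cast this
  refine ⟨_, fun σ hσ => ?_, (card_exists_signedCount_gt_le hshat hε hL (by simpa using hm)).trans
    (by simp)⟩
  simp only [Finset.mem_filter, Finset.mem_univ, true_and, Fintype.card_fin]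
  by_contra! hcon
  -- Nonnegativity of the bound covers an empty index type, where the real supremum is 0.
  refine absurd hσ (not_lt.2 (Real.iSup_le (fun q => ?_) (by positivity)))
  obtain ⟨⟨h, hh⟩, ⟨T, hT⟩⟩ := q
  let A : Finset (Fin m × Bool) := Finset.univ.filter fun i => h (T (z i).1) ≠ (z i).2
  have hA : ∀ i, i ∈ A ↔ h (T (z i).1) ≠ (z i).2 := fun i => by simp [A]
  have h1 := hcon A (mem_lossPatterns.2 ⟨h ∘ T, ⟨h, hh, T, hT, rfl⟩, hA⟩)
  rw [← card_mul_empErr_exchange_sub σ p h T hA, abs_mul, Nat.abs_cast] at h1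
  have hm1 : (0 : ℝ) < m := by exact_mod_cast hm0
  rw [mul_div_assoc] at h1
  exact le_of_mul_le_mul_left h1 hm1

/-! ### From the ghost sample to the true error -/

theorem empErr_nonneg {X : Type*} {m : ℕ} (S : Fin m → X × Label) (h : X → Label) (T : X → X) :
    0 ≤ empErr S h T :=
  mul_nonneg (by positivity) (Finset.sum_nonneg fun _ _ => by split_ifs <;> norm_num)

theorem empErr_le_one {X : Type*} {m : ℕ} (S : Fin m → X × Label) (h : X → Label) (T : X → X) :
    empErr S h T ≤ 1 := by
  have h1 : ∑ i, (if h (T (S i).1) ≠ (S i).2 then (1 : ℝ) else 0) ≤ ∑ _i : Fin m, (1 : ℝ) :=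
    Finset.sum_le_sum fun _ _ => by split_ifs <;> norm_num
  rw [Finset.sum_const, Finset.card_univ, Fintype.card_fin, nsmul_one] at h1
  rw [empErr, one_div, inv_mul_eq_div]
  exact div_le_one_of_le₀ h1 m.cast_nonneg

theorem bddAbove_range_empErr_sub {X : Type*} {m : ℕ} {H : Set (X → Label)} {𝒯 : Set (X → X)}
    (S S' : Fin m → X × Label) :
    BddAbove (Set.range fun q : H × 𝒯 => |empErr S q.1 q.2 - empErr S' q.1 q.2|) := by
  refine ⟨1, ?_⟩
  rintro _ ⟨q, rfl⟩
  have h1 := empErr_nonneg S q.1 q.2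
  have h2 := empErr_le_one S q.1 q.2
  have h3 := empErr_nonneg S' q.1 q.2
  have h4 := empErr_le_one S' q.1 q.2
  exact abs_le.2 ⟨by linarith, by linarith⟩

theorem measurableSet_ne_label {X : Type*} [MeasurableSpace X] {f : X → Label}
    (hf : Measurable f) : MeasurableSet {z : X × Label | f z.1 ≠ z.2} :=
  (measurableSet_eq_fun (hf.comp measurable_fst) measurable_snd).compl

/-- Chebyshev's inequality for the empirical error of a fixed predictor. -/
theorem measure_abs_empErr_sub_err_ge_le {X : Type*} [MeasurableSpace X]
    (D : Measure (X × Label)) [IsProbabilityMeasure D] {h : X → Label} {T : X → X}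
    (hmeas : Measurable (h ∘ T)) {ε : ℝ} (hε : 0 < ε) {m : ℕ} (hm : 8 ≤ m * ε ^ 2) :
    (Measure.pi fun _ : Fin m => D) {S | ε / 4 ≤ |empErr S h T - err D h T|} ≤ 1 / 2 := by
  classical
  have hm0 : (0 : ℝ) < m := by
    by_contra hcon
    have : (m : ℝ) * ε ^ 2 ≤ 0 := mul_nonpos_of_nonpos_of_nonneg (not_lt.1 hcon) (by positivity)
    linarith
  let W : Set (X × Label) := {z | h (T z.1) ≠ z.2}
  have hW : MeasurableSet W := measurableSet_ne_label hmeas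
  let l : X × Label → ℝ := W.indicator 1
  have hl : Measurable l := measurable_one.indicator hW
  have hl01 : ∀ z, l z ∈ Set.Icc (0 : ℝ) 1 := fun z => by
    by_cases hz : z ∈ W <;> simp [l, hz]
  have hlp : MemLp l 2 D := (memLp_const (1 : ℝ)).mono hl.aestronglyMeasurable
    (.of_forall fun z => by
      rw [Real.norm_of_nonneg (hl01 z).1, norm_one]; exact (hl01 z).2)
  let Y : (Fin m → X × Label) → ℝ := ∑ i, fun S => l (S i)
  have hcomp : ∀ i : Fin m, MemLp (fun S : Fin m → X × Label => l (S i)) 2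
      (Measure.pi fun _ => D) := fun i =>
    hlp.comp_measurePreserving (measurePreserving_eval (fun _ : Fin m => D) i)
  have hYp : MemLp Y 2 (Measure.pi fun _ => D) := memLp_finsetSum' _ fun i _ => hcomp i
  -- A variable in `[0, 1]` has variance at most `1 / 4`. Chebyshev then gives `4 / (m ε ^ 2)`,
  -- which is at most `1 / 2` once `m ε ^ 2 ≥ 8`.
  have hvar : ProbabilityTheory.variance Y (Measure.pi fun _ => D) ≤ m / 4 := by
    have h1 := ProbabilityTheory.variance_sum_pi (μ := fun _ : Fin m => D) (X := fun _ => l)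
      fun _ => hlp
    have h2 := ProbabilityTheory.variance_le_sq_of_bounded (μ := D) (.of_forall hl01)
      hl.aemeasurable
    calc _ = _ := h1
      _ ≤ ∑ _i : Fin m, ((1 - 0) / 2 : ℝ) ^ 2 := Finset.sum_le_sum fun _ _ => h2
      _ = m / 4 := by simp; ring
  have hint : ∫ S, Y S ∂(Measure.pi fun _ : Fin m => D) = m * err D h T := by
    simp only [Y, Finset.sum_apply]
    rw [integral_finsetSum _ fun i _ => (hcomp i).integrable (by norm_num)]
    have h3 : ∀ i : Fin m, ∫ S, l (S i) ∂(Measure.pi fun _ : Fin m => D) = err D h T := by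
      intro i
      rw [integral_comp_eval (μ := fun _ : Fin m => D) hl.aestronglyMeasurable]
      simp only [l]
      rw [integral_indicator_one hW]
      rfl
    simp [h3]
  have hY : ∀ S, Y S = m * empErr S h T := by
    intro S
    rw [empErr, ← mul_assoc, mul_one_div_cancel hm0.ne', one_mul]
    simp only [Y, Finset.sum_apply, l, Set.indicator_apply, W, Set.mem_ofPred_eq, Pi.one_apply]
  have hcheb := ProbabilityTheory.meas_ge_le_variance_div_sq hYp
    (c := m * (ε / 4)) (by positivity)
  have hset : {S | ε / 4 ≤ |empErr S h T - err D h T|} =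
      {S | m * (ε / 4) ≤ |Y S - ∫ S, Y S ∂(Measure.pi fun _ : Fin m => D)|} := by
    ext S
    rw [Set.mem_ofPred_eq, Set.mem_ofPred_eq, hint, hY, ← mul_sub, abs_mul, Nat.abs_cast,
      mul_le_mul_iff_right₀ hm0]
  rw [hset]
  refine hcheb.trans ?_
  have : (1 / 2 : ℝ≥0∞) = ENNReal.ofReal (1 / 2) := by
    rw [ENNReal.ofReal_div_of_pos two_pos]; simp
  rw [this]
  refine ENNReal.ofReal_le_ofReal ?_
  rw [div_le_iff₀ (by positivity)]
  nlinarith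

/-- A large deviation from the true error is seen by an independent sample with probability at
least one half. -/
theorem half_le_measure_iSup_gt {X : Type*} [MeasurableSpace X] {H : Set (X → Label)}
    {𝒯 : Set (X → X)} {D : Measure (X × Label)} [IsProbabilityMeasure D] {h : X → Label}
    {T : X → X} (hh : h ∈ H) (hT : T ∈ 𝒯) (hmeas : Measurable (h ∘ T)) {ε : ℝ} (hε : 0 < ε) {m : ℕ}
    (hm : 8 ≤ m * ε ^ 2) {S : Fin m → X × Label} (hS : ε / 2 < |empErr S h T - err D h T|) :
    1 / 2 ≤ (Measure.pi fun _ : Fin m => D)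
      {S' | ε / 4 < ⨆ q : H × 𝒯, |empErr S q.1 q.2 - empErr S' q.1 q.2|} := by
  set E := {S' : Fin m → X × Label | ε / 4 < ⨆ q : H × 𝒯, |empErr S q.1 q.2 - empErr S' q.1 q.2|}
  -- If `S'` is within `ε / 4` of the true error while `S` is off by more than `ε / 2`, the two
  -- samples differ by more than `ε / 4`.
  have hcov : Set.univ ⊆ E ∪ {S' : Fin m → X × Label | ε / 4 ≤ |empErr S' h T - err D h T|} := by
    intro S' _
    by_cases hS' : ε / 4 ≤ |empErr S' h T - err D h T|
    · exact Or.inr hS'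
    · refine Or.inl ?_
      have h1 := le_ciSup (bddAbove_range_empErr_sub (H := H) (𝒯 := 𝒯) S S') (⟨h, hh⟩, ⟨T, hT⟩)
      refine lt_of_lt_of_le ?_ h1
      have h2 := abs_sub_le (empErr S h T) (empErr S' h T) (err D h T)
      simp only
      linarith
  have h1 := (measure_mono hcov).trans (measure_union_le (μ := Measure.pi fun _ : Fin m => D) _ _)
  have h2 := h1.trans
    (add_le_add_right (measure_abs_empErr_sub_err_ge_le D hmeas hε hm) _)
  have h3 := (ENNReal.add_halves 1).trans_le (measure_univ.symm.trans_le h2)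
  exact (ENNReal.add_le_add_iff_right (by simp)).1 h3

/-- Uniform convergence at the rate `√((d + log (1/δ)) / m)`. -/
theorem exists_uniform_convergence {X : Type*} [MeasurableSpace X] {H : Set (X → Label)}
    {𝒯 : Set (X → X)} {D : Measure (X × Label)} [IsProbabilityMeasure D]
    (hwb : IsWellBehaved D H 𝒯) {d : ℕ} (hd : vc (compClass H 𝒯) = d) {ε δ : ℝ} (hε : 0 < ε)
    (hδ : δ ∈ Set.Ioo (0 : ℝ) (1 / 2)) {m : ℕ}
    (hm : 13824 * (d + Real.log (1 / δ)) ≤ m * ε ^ 2) :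
    ∃ G : Set (Fin m → X × Label), MeasurableSet G ∧
      1 - δ ≤ (Measure.pi fun _ : Fin m => D).real G ∧
      ∀ S ∈ G, ∀ h ∈ H, ∀ T ∈ 𝒯, |empErr S h T - err D h T| ≤ ε / 2 := by
  obtain ⟨hδ0, hδ1⟩ := hδ
  have hL : Real.log 2 ≤ Real.log (1 / δ) := by
    refine Real.log_le_log two_pos ?_
    rw [le_div_iff₀ hδ0]
    linarith
  have hl2 := Real.log_two_gt_d9
  have hd0 : (0 : ℝ) ≤ d := d.cast_nonneg
  have hm8 : 8 ≤ m * ε ^ 2 := by linarith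
  have hm0 : 0 < m := by
    rcases Nat.eq_zero_or_pos m with rfl | h
    · norm_num at hm8
    · exact h
  set μ := Measure.pi fun _ : Fin m => D
  set A := {p : (Fin m → X × Label) × (Fin m → X × Label) |
    ε / 4 < ⨆ q : H × 𝒯, |empErr p.1 q.1 q.2 - empErr p.2 q.1 q.2|} with hA
  have hAle : (μ.prod μ) A ≤ ENNReal.ofReal (δ / 2) := by
    have := measure_iSup_empErr_sub_gt_le hwb hd hε hL hm0 hm
    rwa [one_div, Real.log_inv, neg_neg, Real.exp_log hδ0] at this
  -- `A` is only null measurable. A measurable hull of equal measure has measurable sections, and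
  -- makes `B` measurable.
  let A' := toMeasurable (μ.prod μ) A
  have hA' : MeasurableSet A' := measurableSet_toMeasurable _ _
  let B : Set (Fin m → X × Label) := {S | 1 / 2 ≤ μ (Prod.mk S ⁻¹' A')}
  have hmeas : Measurable fun S => μ (Prod.mk S ⁻¹' A') := measurable_measure_prodMk_left hA'
  have hB : MeasurableSet B := measurableSet_le measurable_const hmeas
  have hBle : μ B ≤ ENNReal.ofReal δ := by
    -- Markov's inequality on the section measures: the threshold `1 / 2` doubles `δ / 2` to `δ`.
    have h1 := mul_meas_ge_le_lintegral (μ := μ) hmeas (1 / 2)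
    rw [← Measure.prod_apply hA', measure_toMeasurable] at h1
    have h2 : 1 / 2 * μ B ≤ 1 / 2 * ENNReal.ofReal δ := by
      refine (h1.trans hAle).trans_eq ?_
      rw [div_eq_inv_mul δ 2, ENNReal.ofReal_mul (by positivity), ENNReal.ofReal_inv_of_pos two_pos]
      simp
    exact (ENNReal.mul_le_mul_iff_right (by simp) (by simp)).1 h2
  refine ⟨Bᶜ, hB.compl, ?_, fun S hS h hh T hT => ?_⟩
  · rw [probReal_compl_eq_one_sub hB]
    have : μ.real B ≤ δ := ENNReal.toReal_le_of_le_ofReal hδ0.le hBle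
    linarith
  · by_contra! hcon
    refine hS ((half_le_measure_iSup_gt hh hT (hwb.measurable_comp h hh T hT) hε hm8 hcon).trans ?_)
    exact measure_mono fun S' hS' => subset_toMeasurable _ A hS'

/-! ### The min-max predictor -/

/-- A uniformly accurate sample makes every empirical min-max predictor nearly optimal. -/
theorem worstErr_le_optInf_add {X : Type*} [MeasurableSpace X] {H : Set (X → Label)}
    {𝒯 : Set (X → X)} {D : Measure (X × Label)} [IsProbabilityMeasure D] {ε : ℝ} (hε : 0 ≤ ε)
    {m : ℕ} {S : Fin m → X × Label}
    (hS : ∀ h ∈ H, ∀ T ∈ 𝒯, |empErr S h T - err D h T| ≤ ε / 2) {h : X → Label}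
    (hh : h ∈ minMaxRule H 𝒯 S) : worstErr D 𝒯 h ≤ optInf D H 𝒯 + ε := by
  have hemp : ∀ g, ∀ T : 𝒯, empErr S g T ≤ empWorstErr S 𝒯 g := fun g T =>
    le_ciSup (f := fun T : 𝒯 => empErr S g T)
      ⟨1, by rintro _ ⟨T, rfl⟩; exact empErr_le_one S g T⟩ T
  have herr : ∀ g, ∀ T : 𝒯, err D g T ≤ worstErr D 𝒯 g := fun g T =>
    le_ciSup (f := fun T : 𝒯 => err D g T)
      ⟨1, by rintro _ ⟨T, rfl⟩; exact measureReal_le_one⟩ T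
  have hworst0 : ∀ g, 0 ≤ worstErr D 𝒯 g := fun g => Real.iSup_nonneg fun _ => measureReal_nonneg
  have hemp0 : ∀ g, 0 ≤ empWorstErr S 𝒯 g := fun g => Real.iSup_nonneg fun _ => empErr_nonneg _ _ _
  have : Nonempty H := ⟨⟨h, hh.1⟩⟩
  rw [← sub_le_iff_le_add]
  refine le_ciInf fun g => ?_
  have h1 : worstErr D 𝒯 h ≤ empWorstErr S 𝒯 h + ε / 2 := by
    -- The nonnegativity side goal handles empty `𝒯`, for which both suprema are 0.
    refine Real.iSup_le (fun T => ?_) (by have := hemp0 h; linarith)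
    have h2 := (abs_le.1 (hS h hh.1 T T.2)).1
    have h3 := hemp h T
    linarith
  have h4 : empWorstErr S 𝒯 g ≤ worstErr D 𝒯 g + ε / 2 := by
    refine Real.iSup_le (fun T => ?_) (by have := hworst0 g; linarith)
    have h2 := (abs_le.1 (hS g g.2 T T.2)).2
    have h3 := herr g T
    linarith
  have h5 := hh.2 g g.2
  linarith

theorem theorem1 :
    ∃ C : ℝ, 0 < C ∧
      ∀ (X : Type*) [MeasurableSpace X] (H : Set (X → Label)) (𝒯 : Set (X → X))
        (D : Measure (X × Label)) [IsProbabilityMeasure D],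
        IsWellBehaved D H 𝒯 →
        ∀ d : ℕ, vc (compClass H 𝒯) = d →
        ∀ ε ∈ Set.Ioo (0 : ℝ) (1 / 2), ∀ δ ∈ Set.Ioo (0 : ℝ) (1 / 2),
        ∀ m : ℕ, C * (((d : ℝ) + Real.log (1 / δ)) / ε ^ 2) ≤ (m : ℝ) →
          ∃ G : Set (Fin m → X × Label), MeasurableSet G ∧
            1 - δ ≤ (Measure.pi fun _ : Fin m => D).real G ∧
            ∀ S ∈ G, ∀ h ∈ minMaxRule H 𝒯 S, worstErr D 𝒯 h ≤ optInf D H 𝒯 + ε := by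

  refine ⟨13824, by norm_num, fun X _ H 𝒯 D _ hwb d hd ε hε δ hδ m hm => ?_⟩
  have hm' : 13824 * (d + Real.log (1 / δ)) ≤ m * ε ^ 2 := by
    rwa [← mul_div_assoc, div_le_iff₀ (pow_pos hε.1 2)] at hm
  obtain ⟨G, hG, hGδ, hGS⟩ := exists_uniform_convergence hwb hd hε.1 hδ hm'
  exact ⟨G, hG, hGδ, fun S hS h hh => worstErr_le_optInf_add hε.1.le (hGS S hS) hh⟩
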